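/- Let $(\mathcal M,+,0)$ be a small symmetric monoidal category whose unit $0$ is an initial object. Assume property $(P_0)$: there is a finite set $T$ of objects of $\mathcal M$ such that every object of $\mathcal M$ is a direct factor (that is, a retract) of a finite (possibly empty) monoidal sum $a_1+\dots+a_r$ of elements of $T$. Let $\mathcal A$ be a Grothendieck category. For an object $x$ of $\mathcal M$ and a functor $F:\mathcal M\to\mathcal A$, let $\tau_x(F)=F(x+-)$ and let $\delta_x(F)$ be the cokernel of the natural transformation $F\cong\tau_0(F)\to\tau_x(F)$ induced by the unique morphism $0\to x$. The functor $F$ is called strongly polynomial if there is an integer $d\ge 0$ such that $\delta_{a_0}\cdots\delta_{a_d}(F)=0$ for all objects $a_0,\dots,a_d$ of $\mathcal M$, and pointwise noetherian if $F(c)$ is a noetherian object of $\mathcal A$ for every object $c$ of $\mathcal M$. (An object is noetherian if every increasing sequence of its subobjects is stationary.) Then every strongly polynomial, pointwise noetherian functor $F:\mathcal M\to\mathcal A$ is a noetherian object of the category of functors $\mathcal M\to\mathcal A$. -/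

import Mathlib

open CategoryTheory CategoryTheory.Limits CategoryTheory.MonoidalCategory

universe w v u

namespace PolyFunctor

noncomputable section

section

variable {M : Type w} [SmallCategory.{w} M] [MonoidalCategory M]

/-- The iterated monoidal sum `a₁ + (a₂ + (⋯ + 0))` of a finite list of objects. The monoidal
structure, written `+` with unit `0` on paper, is Mathlib's `⊗` with unit `𝟙_ M`. -/
def monoidalSum (l : List M) : M :=
  l.foldr (fun a b => a ⊗ b) (𝟙_ M)

/-- `T` is a weak monoidal generating set: every object of `M` is a direct factor (i.e. a retract)
of a finite monoidal sum of elements of `T`. -/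
def IsWeakMonoidalGenerating (T : Set M) : Prop :=
  ∀ x : M, ∃ l : List M, (∀ a ∈ l, a ∈ T) ∧ Nonempty (Retract x (monoidalSum l))

variable (M) in
/-- Property `(P₀)`: there is a finite weak monoidal generating set. -/
def PropertyP0 : Prop :=
  ∃ T : Set M, T.Finite ∧ IsWeakMonoidalGenerating T

variable {A : Type u} [Category.{v} A]

/-- The shift functor `τ_x`: precomposition with `x + -`. -/
def shift (x : M) : (M ⥤ A) ⥤ (M ⥤ A) :=
  (Functor.whiskeringLeft M M A).obj (tensorLeft x)

/-- The natural transformation `Id ≅ - ∘ (0 + -) ⟶ - ∘ (x + -)` induced by the unique morphism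
from the initial object `0` to `x`, as a transformation of endofunctors of `M`. -/
def addLeft (h0 : IsInitial (𝟙_ M)) (x : M) : 𝟭 M ⟶ tensorLeft x where
  app t := (λ_ t).inv ≫ h0.to x ▷ t
  naturality s t f := by
    change f ≫ (λ_ t).inv ≫ h0.to x ▷ t = ((λ_ s).inv ≫ h0.to x ▷ s) ≫ x ◁ f
    rw [leftUnitor_inv_naturality_assoc, Category.assoc, whisker_exchange]

/-- The natural transformation `i_x : Id ≅ τ_0 ⟶ τ_x` induced by `0 ⟶ x`. -/
def toShift (h0 : IsInitial (𝟙_ M)) (x : M) : 𝟭 (M ⥤ A) ⟶ shift (A := A) x where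
  app F := F.leftUnitor.inv ≫ Functor.whiskerRight (addLeft h0 x) F
  naturality F G f := by
    ext t
    simp [shift]

variable [Abelian A]

/-- The difference functor `δ_x`: the cokernel of `i_x : Id ⟶ τ_x`. -/
def delta (h0 : IsInitial (𝟙_ M)) (x : M) : (M ⥤ A) ⥤ (M ⥤ A) where
  obj F := cokernel ((toShift h0 x).app F)
  map {F G} f := cokernel.map _ _ f ((shift x).map f) ((toShift h0 x).naturality f).symm
  map_id F := by
    rw [← cancel_epi (cokernel.π _)]; simp
  map_comp f g := by
    rw [← cancel_epi (cokernel.π _)]; simp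

/-- `F` is strongly polynomial of strong degree at most `d`:
`δ_{a₀} ⋯ δ_{a_d} F = 0` for all objects `a₀, …, a_d`. -/
def StronglyPolynomialOfDegreeLE (h0 : IsInitial (𝟙_ M)) (d : ℕ) (F : M ⥤ A) : Prop :=
  ∀ l : List M, l.length = d + 1 → IsZero (l.foldr (fun a G => (delta h0 a).obj G) F)

/-- `F` is strongly polynomial (of some finite degree). -/
def StronglyPolynomial (h0 : IsInitial (𝟙_ M)) (F : M ⥤ A) : Prop :=
  ∃ d : ℕ, StronglyPolynomialOfDegreeLE h0 d F

end

section

/-- `F` takes noetherian values. -/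
def PointwiseNoetherian {M : Type w} [SmallCategory.{w} M] {A : Type u} [Category.{v} A]
    (F : M ⥤ A) : Prop :=
  ∀ c : M, IsNoetherianObject (F.obj c)

end

end

end PolyFunctor

/-! ### Subobjects in abelian categories -/

namespace CategoryTheory.Subobject

open CategoryTheory CategoryTheory.Limits

universe v₁ u₁

section

variable {C : Type u₁} [Category.{v₁} C]

/-! Let `s` be the sum of all elements of a nonempty finite set `T`. A sum of elements of `T` either
omits some element of `T`, or is `s + t` with `t` a shorter such sum. By exactness of `F(t) ⟶ F(s +
t) ⟶ δ_s F(t) ⟶ 0`, an increasing chain of subfunctors is controlled at `s + t` by its images in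
`δ_s F`, which has lower degree, and its preimages in `F(t)`, the saturations. Induction on `T`,
then on the degree, settles everything except the saturations.

Saturating the `n`-th term `n` times gives a chain that absorbs its own saturations; induction on
the length of sums makes it stationary (`stationaryOn_of_saturation_le`). Hence, for some `N`, the
chain of `N`-fold saturations is stationary, and the saturations are removed one at a time
(`stationaryOn_of_saturation_stationaryOn`). The index obtained serves all sums at once, so it
passes to their retracts, that is, to all objects. -/

lemma le_of_forall_factors {X : C} {S S' : Subobject X}
    (h : ∀ ⦃Z : C⦄ (f : Z ⟶ X), S.Factors f → S'.Factors f) : S ≤ S' :=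
  le_of_comm (S'.factorThru S.arrow (h _ S.factors_self)) (factorThru_arrow _ _ _)

lemma factors_pullback_obj_iff [HasPullbacks C] {X Y Z : C} (f : X ⟶ Y) (S : Subobject Y)
    (h : Z ⟶ X) : ((pullback f).obj S).Factors h ↔ S.Factors (h ≫ f) := by
  refine ⟨fun H => ?_, fun H => ?_⟩
  · refine (factors_iff _ _).2 ⟨factorThru _ h H ≫ pullbackπ f S, ?_⟩
    change (_ ≫ _) ≫ S.arrow = _
    rw [Category.assoc, (isPullback f S).w, factorThru_arrow_assoc]
  · refine (factors_iff _ _).2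
      ⟨(isPullback f S).lift (factorThru _ _ H) h (factorThru_arrow _ _ _), ?_⟩
    exact (isPullback f S).lift_snd _ _ _

end

variable {C : Type u₁} [Category.{v₁} C] [Abelian C]

/-- Factoring through `S` means being killed by the cokernel of its arrow, which can be tested after
an epimorphism. -/
lemma factors_of_epi_comp {X Y Z : C} (S : Subobject X) (e : Z ⟶ Y) [Epi e] (f : Y ⟶ X)
    (h : S.Factors (e ≫ f)) : S.Factors f := by
  have h0 : f ≫ cokernel.π S.arrow = 0 := by
    rw [← cancel_epi e, ← Category.assoc, ← factorThru_arrow _ _ h, Category.assoc,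
      cokernel.condition, comp_zero, comp_zero]
  exact (factors_iff _ _).2 ⟨Abelian.monoLift S.arrow f h0, Abelian.monoLift_comp S.arrow f h0⟩

/-- If `P ⟶ Q ⟶ R` is exact, comparable subobjects of `Q` with the same image in `R` and the same
preimage in `P` are equal. -/
lemma le_of_imageSubobject_le_of_pullback_le {T : ShortComplex C} (hT : T.Exact)
    {U V : Subobject T.X₂} (hUV : U ≤ V)
    (him : imageSubobject (V.arrow ≫ T.g) ≤ imageSubobject (U.arrow ≫ T.g))
    (hpre : (pullback T.f).obj V ≤ (pullback T.f).obj U) : V ≤ U := by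
  have hV : (imageSubobject (U.arrow ≫ T.g)).Factors (V.arrow ≫ T.g) :=
    factors_of_le _ him ((factors_iff _ _).2
      ⟨factorThruImageSubobject _, imageSubobject_arrow_comp _⟩)
  obtain ⟨A, e, he, u, hu⟩ := surjective_up_to_refinements_of_epi
    (factorThruImageSubobject (U.arrow ≫ T.g)) (factorThru _ _ hV)
  have hu' : e ≫ V.arrow ≫ T.g = u ≫ U.arrow ≫ T.g := by
    have := hu =≫ (imageSubobject (U.arrow ≫ T.g)).arrow
    simpa using this
  -- The elements of `V` and `U` have the same image, so up to refinement their difference comes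
  -- from `p` in `T.X₁`. Since `U ≤ V`, this `p` lies in the preimage of `V`, hence in that of `U`.
  obtain ⟨A', e', he', p, hp⟩ := hT.exact_up_to_refinements (e ≫ V.arrow - u ≫ U.arrow)
    (by simp [hu'])
  have hpV : V.Factors (p ≫ T.f) := by
    rw [← hp]
    have : e' ≫ (e ≫ V.arrow - u ≫ U.arrow) = (e' ≫ (e - u ≫ ofLE U V hUV)) ≫ V.arrow := by simp
    rw [this]
    exact factors_comp_arrow _
  have hpU : U.Factors (p ≫ T.f) :=
    (factors_pullback_obj_iff _ _ _).1
      (factors_of_le _ hpre ((factors_pullback_obj_iff _ _ _).2 hpV))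
  have key : U.Factors ((e' ≫ e) ≫ V.arrow) := by
    have : (e' ≫ e) ≫ V.arrow = p ≫ T.f + (e' ≫ u) ≫ U.arrow := by
      rw [← hp]; simp
    rw [this]
    exact factors_add _ _ hpU (factors_comp_arrow _)
  have := epi_comp e' e
  have h := factors_of_epi_comp U (e' ≫ e) V.arrow key
  exact le_of_comm (factorThru _ _ h) (factorThru_arrow _ _ _)

lemma imageSubobject_arrow_comp_mono {X Y : C} (p : X ⟶ Y) {U V : Subobject X} (h : U ≤ V) :
    imageSubobject (U.arrow ≫ p) ≤ imageSubobject (V.arrow ≫ p) :=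
  imageSubobject_le _ (ofLE U V h ≫ factorThruImageSubobject (V.arrow ≫ p)) (by simp)

lemma imageSubobject_le_pullback_imageSubobject {X Y X' Y' : C} {p : X ⟶ Y} {p' : X' ⟶ Y'}
    {g : X ⟶ X'} {f : Y ⟶ Y'} (w : g ≫ p' = p ≫ f) {S : Subobject X} {S' : Subobject X'}
    (h : S ≤ (pullback g).obj S') :
    imageSubobject (S.arrow ≫ p) ≤ (pullback f).obj (imageSubobject (S'.arrow ≫ p')) := by
  have hS : S'.Factors (S.arrow ≫ g) :=
    (factors_pullback_obj_iff _ _ _).1 (factors_of_le _ h S.factors_self)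
  have hfac : ((pullback f).obj (imageSubobject (S'.arrow ≫ p'))).Factors (S.arrow ≫ p) := by
    rw [factors_pullback_obj_iff, Category.assoc, ← w, ← Category.assoc,
      ← factorThru_arrow _ _ hS, Category.assoc]
    exact factors_of_factors_right _ ((factors_iff _ _).2
      ⟨factorThruImageSubobject _, imageSubobject_arrow_comp _⟩)
  exact imageSubobject_le _ (factorThru _ _ hfac) (factorThru_arrow _ _ hfac)

lemma pullback_le_pullback_of_comm {X Y X' Y' : C} {i : X ⟶ Y} {i' : X' ⟶ Y'}
    {f : X ⟶ X'} {g : Y ⟶ Y'} (w : f ≫ i' = i ≫ g) {S : Subobject Y} {S' : Subobject Y'}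
    (h : S ≤ (pullback g).obj S') :
    (pullback i).obj S ≤ (pullback f).obj ((pullback i').obj S') := by
  rw [← pullback_comp, w, pullback_comp]
  exact (pullback i).monotone h

end CategoryTheory.Subobject

namespace CategoryTheory

open CategoryTheory.Limits

universe v₁ u₁

/-- Pullback along an epimorphism is injective on subobjects, so chains can be tested upstairs. -/
lemma isNoetherianObject_of_epi {C : Type u₁} [Category.{v₁} C] [Abelian C]
    {X Y : C} (f : X ⟶ Y) [Epi f] [IsNoetherianObject X] : IsNoetherianObject Y := by
  have hinj : Function.Injective (Subobject.pullback f).obj := by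
    have hle : ∀ U V : Subobject Y,
        (Subobject.pullback f).obj U = (Subobject.pullback f).obj V → U ≤ V := by
      refine fun U V h => Subobject.le_of_forall_factors fun Z g hg => ?_
      obtain ⟨Z', e, he, k, hk⟩ := surjective_up_to_refinements_of_epi f g
      refine V.factors_of_epi_comp e g ?_
      rw [hk, ← Subobject.factors_pullback_obj_iff, ← h, Subobject.factors_pullback_obj_iff, ← hk]
      exact Subobject.factors_of_factors_right _ hg
    exact fun U V h => le_antisymm (hle U V h) (hle V U h.symm)
  rw [isNoetherianObject_iff_monotone_chain_condition]
  intro c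
  obtain ⟨n, hn⟩ := monotone_chain_condition_of_isNoetherianObject
    ⟨_, (Subobject.pullback f).monotone.comp c.2⟩
  exact ⟨n, fun m hm => hinj (hn m hm)⟩

end CategoryTheory

namespace PolyFunctor

/-! ### Finite monoidal sums -/

section Sums

variable {M : Type w} [SmallCategory.{w} M] [MonoidalCategory M]

lemma monoidalSum_append (l l' : List M) :
    Nonempty (monoidalSum (l ++ l') ≅ monoidalSum l ⊗ monoidalSum l') := by
  induction l with
  | nil => exact ⟨(λ_ _).symm⟩
  | cons a l ih =>
    obtain ⟨e⟩ := ih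
    exact ⟨whiskerLeftIso a e ≪≫ (α_ a (monoidalSum l) (monoidalSum l')).symm⟩

lemma monoidalSum_perm [SymmetricCategory M] {l l' : List M} (h : l.Perm l') :
    Nonempty (monoidalSum l ≅ monoidalSum l') := by
  induction h with
  | nil => exact ⟨Iso.refl _⟩
  | cons a _ ih =>
    obtain ⟨e⟩ := ih
    exact ⟨whiskerLeftIso a e⟩
  | swap a b l =>
    exact ⟨(α_ b a (monoidalSum l)).symm ≪≫ whiskerRightIso (β_ b a) (monoidalSum l) ≪≫
      α_ a b (monoidalSum l)⟩
  | trans _ _ ih₁ ih₂ =>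
    obtain ⟨e₁⟩ := ih₁
    obtain ⟨e₂⟩ := ih₂
    exact ⟨e₁ ≪≫ e₂⟩

open Classical in
/-- A sum of elements of `T` either avoids some element of `T`, or contains the sum of all elements
of `T` as a summand. -/
lemma exists_erase_or_monoidalSum_iso [SymmetricCategory M] (T : Finset M) (l : List M)
    (hl : ∀ a ∈ l, a ∈ T) :
    (∃ a ∈ T, ∀ b ∈ l, b ∈ T.erase a) ∨
      ∃ l' : List M, (∀ a ∈ l', a ∈ T) ∧ l.length = T.card + l'.length ∧
        Nonempty (monoidalSum l ≅ monoidalSum T.toList ⊗ monoidalSum l') := by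
  by_cases h : T.toList ⊆ l
  · right
    -- `T.toList` has no repetition, so containment of elements gives containment with multiplicity.
    obtain ⟨l₁, hl₁, hsub⟩ := List.subperm_of_subset T.nodup_toList h
    obtain ⟨l', hl'⟩ := hsub.exists_perm_append
    have hp : l.Perm (T.toList ++ l') := hl'.trans (hl₁.append_right l')
    refine ⟨l', fun a ha => hl a (hp.mem_iff.2 (by simp [ha])), by simp [hp.length_eq], ?_⟩
    obtain ⟨e⟩ := monoidalSum_perm hp
    obtain ⟨e'⟩ := monoidalSum_append T.toList l'
    exact ⟨e ≪≫ e'⟩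
  · left
    obtain ⟨a, ha, hal⟩ : ∃ a ∈ T, a ∉ l := by simpa [List.subset_def] using h
    exact ⟨a, ha, fun b hb => Finset.mem_erase.2 ⟨fun hba => hal (hba ▸ hb), hl b hb⟩⟩

end Sums

/-! ### Subfunctors as families of subobjects -/

section Subfunctors

variable {M : Type w} [SmallCategory.{w} M] {A : Type u} [Category.{v} A] [HasPullbacks A]

/-- A subfunctor of `F`, as a family of subobjects of the values of `F`. -/
def Subfamily (F : M ⥤ A) : Type _ :=
  { S : ∀ c, Subobject (F.obj c) //
    ∀ ⦃c c' : M⦄ (f : c ⟶ c'), S c ≤ (Subobject.pullback (F.map f)).obj (S c') }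

namespace Subfamily

variable {F : M ⥤ A}

instance : PartialOrder (Subfamily F) := inferInstanceAs (PartialOrder (Subtype _))

lemma le_of_retract {S S' : Subfamily F} {c c' : M} (r : Retract c c')
    (h : S.1 c' ≤ S'.1 c') : S.1 c ≤ S'.1 c :=
  calc S.1 c ≤ (Subobject.pullback (F.map r.i)).obj (S.1 c') := S.2 r.i
    _ ≤ (Subobject.pullback (F.map r.i)).obj (S'.1 c') := (Subobject.pullback _).monotone h
    _ ≤ (Subobject.pullback (F.map r.i)).obj
          ((Subobject.pullback (F.map r.r)).obj (S'.1 c)) :=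
      (Subobject.pullback _).monotone (S'.2 r.r)
    _ = S'.1 c := by
      rw [← Subobject.pullback_comp, ← F.map_comp, r.retract, F.map_id, Subobject.pullback_id]

lemma le_of_iso {S S' : Subfamily F} {c c' : M} (e : c ≅ c')
    (h : S.1 c' ≤ S'.1 c') : S.1 c ≤ S'.1 c :=
  le_of_retract ⟨e.hom, e.inv, e.hom_inv_id⟩ h

end Subfamily

end Subfunctors

section FunctorCategory

variable {M : Type w} [SmallCategory.{w} M] {A : Type u} [Category.{v} A] [Abelian A]

/-- The family of values of a subobject in the functor category. -/
noncomputable def valueSubfamily {F : M ⥤ A} (X : Subobject F) : Subfamily F :=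
  ⟨fun c => Subobject.mk (X.arrow.app c), fun c c' f => Subobject.le_of_factors <| by
    rw [Subobject.factors_pullback_obj_iff]
    refine (Subobject.mk_factors_iff _ _).2
      ⟨(Subobject.underlyingIso _).hom ≫ (X : M ⥤ A).map f, ?_⟩
    change (_ ≫ _) ≫ X.arrow.app c' = _
    rw [Category.assoc, X.arrow.naturality, ← Category.assoc,
      Subobject.underlyingIso_hom_comp_eq_mk]⟩

lemma le_iff_valueSubfamily_le {F : M ⥤ A} (X Y : Subobject F) :
    X ≤ Y ↔ valueSubfamily X ≤ valueSubfamily Y := by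
  constructor
  · intro h c
    refine Subobject.mk_le_mk_of_comm ((Subobject.ofLE X Y h).app c) ?_
    rw [← NatTrans.comp_app, Subobject.ofLE_arrow]
  · intro h
    have h' : ∀ c, Subobject.mk (X.arrow.app c) ≤ Subobject.mk (Y.arrow.app c) := h
    refine Subobject.le_of_comm
      { app := fun c => Subobject.ofMkLEMk _ _ (h' c)
        naturality := fun c c' f => ?_ } ?_
    · rw [← cancel_mono (Y.arrow.app c')]
      simp only [Category.assoc, Subobject.ofMkLEMk_comp, NatTrans.naturality]
      rw [← Category.assoc, Subobject.ofMkLEMk_comp]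
    · ext c
      exact Subobject.ofMkLEMk_comp (h' c)

/-- The chain condition on families of subobjects suffices for a functor to be noetherian. -/
lemma isNoetherianObject_of_subfamily_chains (F : M ⥤ A)
    (h : ∀ X : ℕ →o Subfamily F, ∃ N, ∀ m, X m ≤ X N) : IsNoetherianObject F := by
  rw [isNoetherianObject_iff_monotone_chain_condition]
  intro X
  obtain ⟨N, hN⟩ := h ⟨fun n => valueSubfamily (X n), fun i j hij =>
    (le_iff_valueSubfamily_le _ _).1 (X.2 hij)⟩
  exact ⟨N, fun m hm => le_antisymm (X.2 hm) ((le_iff_valueSubfamily_le _ _).2 (hN m))⟩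

end FunctorCategory

/-! ### Image and preimage of a subfunctor under the difference sequence -/

section Difference

variable {M : Type w} [SmallCategory.{w} M] [MonoidalCategory M]
  {A : Type u} [Category.{v} A] [Abelian A] (h0 : IsInitial (𝟙_ M))

/-- The exact sequence `F(t) ⟶ F(x + t) ⟶ δ_x F(t) ⟶ 0`. -/
noncomputable def deltaComplex (x : M) (F : M ⥤ A) (t : M) : ShortComplex A :=
  (ShortComplex.mk _ _ (cokernel.condition ((toShift h0 x).app F))).map
    ((evaluation M A).obj t)

lemma deltaComplex_exact (x : M) (F : M ⥤ A) (t : M) : (deltaComplex h0 x F t).Exact :=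
  (ShortComplex.exact_cokernel ((toShift h0 x).app F)).map ((evaluation M A).obj t)

instance epi_deltaComplex_g (x : M) (F : M ⥤ A) (t : M) : Epi (deltaComplex h0 x F t).g := by
  have : Epi (((evaluation M A).obj t).map (cokernel.π ((toShift h0 x).app F))) := inferInstance
  exact this

lemma PointwiseNoetherian.delta {F : M ⥤ A} (hF : PointwiseNoetherian F) (x : M) :
    PointwiseNoetherian ((delta h0 x).obj F) := fun t =>
  have : IsNoetherianObject (deltaComplex h0 x F t).X₂ := hF (x ⊗ t)
  have : IsNoetherianObject (deltaComplex h0 x F t).X₃ :=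
    isNoetherianObject_of_epi (deltaComplex h0 x F t).g
  this

/-- The image in `δ_x F` of the shift of a subfunctor of `F`. -/
noncomputable def deltaImage (x : M) {F : M ⥤ A} (S : Subfamily F) :
    Subfamily ((delta h0 x).obj F) :=
  ⟨fun t => imageSubobject ((S.1 (x ⊗ t)).arrow ≫ (deltaComplex h0 x F t).g), fun _ _ f =>
    Subobject.imageSubobject_le_pullback_imageSubobject
      ((cokernel.π ((toShift h0 x).app F)).naturality f) (S.2 (x ◁ f))⟩

lemma deltaImage_mono (x : M) {F : M ⥤ A} :
    Monotone (deltaImage h0 x : Subfamily F → Subfamily ((delta h0 x).obj F)) :=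
  fun _ _ h t => Subobject.imageSubobject_arrow_comp_mono _ (h (x ⊗ t))

/-- The subfunctor of `F` of elements whose image under `F ⟶ τ_x F` lies in the shift of `S`. -/
noncomputable def saturation (x : M) {F : M ⥤ A} (S : Subfamily F) : Subfamily F :=
  ⟨fun t => (Subobject.pullback (deltaComplex h0 x F t).f).obj (S.1 (x ⊗ t)), fun _ _ f =>
    Subobject.pullback_le_pullback_of_comm (((toShift h0 x).app F).naturality f) (S.2 (x ◁ f))⟩

lemma saturation_mono (x : M) {F : M ⥤ A} :
    Monotone (saturation h0 x : Subfamily F → Subfamily F) :=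
  fun _ _ h t => (Subobject.pullback _).monotone (h (x ⊗ t))

lemma le_saturation (x : M) {F : M ⥤ A} (S : Subfamily F) : S ≤ saturation h0 x S := by
  intro t
  have : (deltaComplex h0 x F t).f = F.map ((addLeft h0 x).app t) := Category.id_comp _
  change _ ≤ (Subobject.pullback (deltaComplex h0 x F t).f).obj _
  rw [this]
  exact S.2 _

lemma le_of_deltaImage_le_of_saturation_le (x : M) {F : M ⥤ A} {S S' : Subfamily F} {t : M}
    (h : S ≤ S') (him : (deltaImage h0 x S').1 t ≤ (deltaImage h0 x S).1 t)
    (hsat : (saturation h0 x S').1 t ≤ (saturation h0 x S).1 t) :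
    S'.1 (x ⊗ t) ≤ S.1 (x ⊗ t) :=
  Subobject.le_of_imageSubobject_le_of_pullback_le (deltaComplex_exact h0 x F t) (h _) him hsat

end Difference

/-! ### Stationary chains on sums -/

section Chains

variable {M : Type w} [SmallCategory.{w} M] [MonoidalCategory M]
  {A : Type u} [Category.{v} A] [Abelian A]

/-- The chain of subfunctors `X` is stationary on the sums of elements of `T`. -/
def StationaryOn {F : M ⥤ A} (T : Finset M) (X : ℕ → Subfamily F) : Prop :=
  ∃ N, ∀ m, ∀ l : List M, (∀ a ∈ l, a ∈ T) →
    (X m).1 (monoidalSum l) ≤ (X N).1 (monoidalSum l)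

/-- Every later index also works, so finitely many stationarity conditions share one index. -/
lemma StationaryOn.eventually {F : M ⥤ A} {T : Finset M} {X : ℕ → Subfamily F}
    (hX : Monotone X) (h : StationaryOn T X) :
    ∀ᶠ N in Filter.atTop, ∀ m, ∀ l : List M, (∀ a ∈ l, a ∈ T) →
      (X m).1 (monoidalSum l) ≤ (X N).1 (monoidalSum l) := by
  obtain ⟨N, hN⟩ := h
  filter_upwards [Filter.eventually_ge_atTop N] with n hn m l hl
  exact (hN m l hl).trans (hX hn _)

lemma stationaryOn_empty {F : M ⥤ A} (hF : PointwiseNoetherian F) {X : ℕ → Subfamily F}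
    (hX : Monotone X) : StationaryOn ∅ X := by
  have := hF (𝟙_ M)
  obtain ⟨N, hN⟩ := monotone_chain_condition_of_isNoetherianObject (X := F.obj (𝟙_ M))
    ⟨fun n => (X n).1 (𝟙_ M), fun i j hij => hX hij _⟩
  refine ⟨N, fun m l hl => ?_⟩
  obtain rfl : l = [] := List.eq_nil_iff_forall_not_mem.2 fun a ha => by simpa using hl a ha
  exact (hX (le_max_right N m) _).trans (hN _ (le_max_left N m)).ge

variable [SymmetricCategory M] (h0 : IsInitial (𝟙_ M))

open Classical in
-- Removes one saturation: on sums containing `s`, stationary images and preimages force the chain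
-- to be stationary.
lemma stationaryOn_of_saturation_stationaryOn {F : M ⥤ A} {T : Finset M} {X : ℕ → Subfamily F}
    (hX : Monotone X)
    (herase : ∀ a ∈ T, StationaryOn (T.erase a) X)
    (hdelta : StationaryOn T fun n => deltaImage h0 (monoidalSum T.toList) (X n))
    (hsat : StationaryOn T fun n => saturation h0 (monoidalSum T.toList) (X n)) :
    StationaryOn T X := by
  have h₁ := (Filter.eventually_all_finset T).2 fun a ha => (herase a ha).eventually hX
  have h₂ := hdelta.eventually ((deltaImage_mono h0 _).comp hX)
  have h₃ := hsat.eventually ((saturation_mono h0 _).comp hX)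
  obtain ⟨N, h₁, h₂, h₃⟩ := (h₁.and (h₂.and h₃)).exists
  refine ⟨N, fun m l hl => ?_⟩
  rcases exists_erase_or_monoidalSum_iso T l hl with ⟨a, ha, hla⟩ | ⟨l', hl', -, ⟨e⟩⟩
  · exact h₁ a ha m l hla
  · refine Subfamily.le_of_iso e ((hX (le_max_left m N) _).trans ?_)
    exact le_of_deltaImage_le_of_saturation_le h0 _ (hX (le_max_right m N)) (h₂ _ l' hl')
      (h₃ _ l' hl')

open Classical in
lemma stationaryOn_of_saturation_le {F : M ⥤ A} {T : Finset M} (hT : T.Nonempty)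
    {X : ℕ → Subfamily F} (hX : Monotone X)
    (herase : ∀ a ∈ T, StationaryOn (T.erase a) X)
    (hdelta : StationaryOn T fun n => deltaImage h0 (monoidalSum T.toList) (X n))
    (hsat : ∀ n, saturation h0 (monoidalSum T.toList) (X n) ≤ X (n + 1)) :
    StationaryOn T X := by
  have h₁ := (Filter.eventually_all_finset T).2 fun a ha => (herase a ha).eventually hX
  have h₂ := hdelta.eventually ((deltaImage_mono h0 _).comp hX)
  obtain ⟨N, h₁, h₂⟩ := (h₁.and h₂).exists
  refine ⟨N, fun m l hl => ?_⟩
  induction hn : l.length using Nat.strong_induction_on generalizing l m with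
  | _ n ih =>
    rcases exists_erase_or_monoidalSum_iso T l hl with ⟨a, ha, hla⟩ | ⟨l', hl', hlen, ⟨e⟩⟩
    · exact h₁ a ha m l hla
    · refine Subfamily.le_of_iso e ((hX (le_max_left m N) _).trans ?_)
      refine le_of_deltaImage_le_of_saturation_le h0 _ (hX (le_max_right m N)) (h₂ _ l' hl') ?_
      -- The saturation of a term lies in the next term, which at the shorter sum lies in `X N` by
      -- induction, hence in the saturation of `X N`.
      refine (hsat _ _).trans ((ih l'.length ?_ _ l' hl' rfl).trans (le_saturation h0 _ _ _))
      have := hT.card_pos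
      omega

open Classical in
lemma stationaryOn_of_delta {F : M ⥤ A} {T : Finset M} (hT : T.Nonempty)
    (herase : ∀ a ∈ T, ∀ X : ℕ → Subfamily F, Monotone X → StationaryOn (T.erase a) X)
    (hdelta : ∀ Y : ℕ → Subfamily ((delta h0 (monoidalSum T.toList)).obj F), Monotone Y →
      StationaryOn T Y)
    (X : ℕ → Subfamily F) (hX : Monotone X) : StationaryOn T X := by
  set s := monoidalSum T.toList
  have hmono : ∀ k, Monotone fun n => (saturation h0 s)^[k] (X n) := fun k =>
    ((saturation_mono h0 s).iterate k).comp hX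
  have hmono' : ∀ n, Monotone fun k => (saturation h0 s)^[k] (X n) := fun n =>
    monotone_nat_of_le_succ fun k => by
      rw [Function.iterate_succ_apply']
      exact le_saturation h0 s _
  -- This diagonal chain absorbs saturation: saturating its `n`-th term saturates `X n` in all `n +
  -- 1` times, which is contained in the next term.
  have hdiag : Monotone fun n => (saturation h0 s)^[n] (X n) := fun i j hij =>
    (hmono i hij).trans (hmono' j hij)
  obtain ⟨N, hN⟩ : StationaryOn T fun n => (saturation h0 s)^[n] (X n) := by
    refine stationaryOn_of_saturation_le h0 hT hdiag (fun a ha => herase a ha _ hdiag)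
      (hdelta _ ((deltaImage_mono h0 s).comp hdiag)) fun n => ?_
    rw [← Function.iterate_succ_apply' (saturation h0 s)]
    exact hmono (n + 1) n.le_succ
  have hstep : ∀ k, StationaryOn T (fun n => (saturation h0 s)^[k] (X n)) → StationaryOn T X := by
    intro k
    induction k with
    | zero => exact id
    | succ k ih =>
      intro h
      refine ih (stationaryOn_of_saturation_stationaryOn h0 (hmono k)
        (fun a ha => herase a ha _ (hmono k)) (hdelta _ ((deltaImage_mono h0 s).comp (hmono k))) ?_)
      simpa only [Function.iterate_succ_apply'] using h
  -- The `N`-fold saturation of `X m` lies in the diagonal term of index `max m N`, hence on sums in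
  -- that of index `N`, which is the `N`-fold saturation of `X N`.
  refine hstep N ⟨N, fun m l hl => ?_⟩
  refine (hmono N (le_max_left m N) _).trans ((hmono' (max m N) (le_max_right m N) _).trans ?_)
  exact hN (max m N) l hl

theorem stationaryOn_of_polynomial (T : Finset M) (d : ℕ) (F : M ⥤ A)
    (hpoly : ∀ l : List M, l.length = d → IsZero (l.foldr (fun a G => (delta h0 a).obj G) F))
    (hF : PointwiseNoetherian F) (X : ℕ → Subfamily F) (hX : Monotone X) : StationaryOn T X := by
  classical
  induction T using Finset.strongInduction generalizing d F with
  | H T ihT =>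
    rcases T.eq_empty_or_nonempty with rfl | hT
    · exact stationaryOn_empty hF hX
    induction d generalizing F with
    | zero =>
      -- Here `d` counts the difference functors applied, one more than the degree bound, so `d = 0`
      -- means that `F` vanishes.
      have hz : IsZero F := hpoly [] rfl
      refine ⟨0, fun m l _ => ?_⟩
      have := Subobject.subsingleton_of_isZero (hz.obj (monoidalSum l))
      exact (Subsingleton.elim _ _).le
    | succ d ihd =>
      refine stationaryOn_of_delta h0 hT
        (fun a ha Y hY => ihT _ (Finset.erase_ssubset ha) (d + 1) F hpoly hF Y hY)
        (fun Y hY => ihd _ (fun l hl => ?_) (hF.delta h0 _) Y hY) X hX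
      -- `foldr` applies the last entry first, so appending the sum puts its difference functor
      -- innermost.
      simpa using hpoly (l ++ [monoidalSum T.toList]) (by simp [hl])

end Chains

end PolyFunctor

theorem mainTheorem9
    {M : Type w} [SmallCategory.{w} M] [MonoidalCategory M] [SymmetricCategory M]
    (h0 : IsInitial (𝟙_ M)) (hP0 : PolyFunctor.PropertyP0 M)
    {A : Type u} [Category.{v} A] [Abelian A] [IsGrothendieckAbelian.{w} A]
    (F : M ⥤ A) (hpoly : PolyFunctor.StronglyPolynomial h0 F)
    (hnoeth : PolyFunctor.PointwiseNoetherian F) :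
    IsNoetherianObject F := by
  obtain ⟨T, hT, hgen⟩ := hP0
  obtain ⟨d, hd⟩ := hpoly
  refine PolyFunctor.isNoetherianObject_of_subfamily_chains F fun X => ?_
  obtain ⟨N, hN⟩ := PolyFunctor.stationaryOn_of_polynomial h0 hT.toFinset (d + 1) F hd hnoeth X X.2
  refine ⟨N, fun m c => ?_⟩
  obtain ⟨l, hl, ⟨r⟩⟩ := hgen c
  exact PolyFunctor.Subfamily.le_of_retract r (hN m l fun a ha => by simpa using hl a ha)
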